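/- All graphs are finite and simple. A graph $\Gamma$ is *$k$-isoregular* if for every set $X$ of at most $k$ vertices the number of vertices $v\notin X$ adjacent to every element of $X$ depends only on the isomorphism type of the subgraph of $\Gamma$ induced by $X$. For a vertex $v$, the *second subconstituent* $\Gamma_2(v)$ is the subgraph induced by the vertices different from $v$ and not adjacent to $v$. A graph satisfies the *$t$-vertex condition* if for every graph $H$ of order at most $t$ with two (possibly equal) distinguished vertices $a,b$, the number of induced subgraphs of $\Gamma$ that contain given vertices $x,y$ and are isomorphic to $H$ by an isomorphism taking $x$ to $a$ and $y$ to $b$ depends only on whether $x=y$, or $x,y$ are adjacent, or $x,y$ are distinct and non-adjacent. A *partial linear space of order $(s,t)$* is an incidence structure of points and lines in which every line is incident with $s+1$ points, every point is incident with $t+1$ lines, and through any two distinct points there is at most one line. Two distinct points are *collinear* if some line is incident with both; the *point graph* has the points as vertices, with two points adjacent if and only if they are collinear. A *generalized quadrangle of order $(s,t)$* is a partial linear space of order $(s,t)$ such that for every point $P$ and line $\ell$ not incident with $P$ there is a unique point on $\ell$ collinear with $P$. A *partial quadrangle with parameters $(s,t,\mu)$* is a partial linear space of order $(s,t)$ such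 that any three pairwise collinear points are incident with a common line, and any two distinct non-collinear points have exactly $\mu$ points collinear with both. Here $s,t,\mu$ are non-negative integers. **Corollary.** Let $\Gamma$ be the (finite) point graph of a partial quadrangle, and suppose that $\Gamma$ is $3$-isoregular. Then for every vertex $v$ of $\Gamma$ the second subconstituent $\Gamma_2(v)$ satisfies the $6$-vertex condition. In particular, if $\Gamma$ is the point graph of a generalized quadrangle of order $(q,q^2)$, then $\Gamma_2(v)$ satisfies the $6$-vertex condition for every vertex $v$ of $\Gamma$. -/

import Mathlib

universe u v

/-- `Γ` is `k`-isoregular: for every set `X` of at most `k` vertices, the number of vertices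
outside `X` adjacent to all elements of `X` depends only on the isomorphism type of the subgraph
induced by `X`. -/
def SimpleGraph.IsIsoregular {V : Type u} (Γ : SimpleGraph V) (k : ℕ) : Prop :=
  ∀ X Y : Finset V, X.card ≤ k → Y.card ≤ k →
    Nonempty (Γ.induce (X : Set V) ≃g Γ.induce (Y : Set V)) →
    {w : V | w ∉ X ∧ ∀ x ∈ X, Γ.Adj w x}.ncard = {w : V | w ∉ Y ∧ ∀ y ∈ Y, Γ.Adj w y}.ncard

/-- The second subconstituent `Γ₂(v)`: the subgraph induced by the non-neighbours of `v`
other than `v` itself. -/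
def SimpleGraph.secondSubconstituent {V : Type u} (Γ : SimpleGraph V) (v : V) :
    SimpleGraph ({w : V | w ≠ v ∧ ¬ Γ.Adj v w} : Set V) :=
  Γ.induce {w : V | w ≠ v ∧ ¬ Γ.Adj v w}

/-- The number of induced subgraphs of `Γ` (given by their vertex sets `S`) that contain `x` and
`y` and are isomorphic to `H` by an isomorphism mapping `x` to `a` and `y` to `b`. -/
noncomputable def SimpleGraph.typeCount {V : Type u} (Γ : SimpleGraph V) {n : ℕ}
    (H : SimpleGraph (Fin n)) (a b : Fin n) (x y : V) : ℕ :=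
  {S : Set V | ∃ (hx : x ∈ S) (hy : y ∈ S) (φ : Γ.induce S ≃g H),
    φ ⟨x, hx⟩ = a ∧ φ ⟨y, hy⟩ = b}.ncard

/-- The `t`-vertex condition: for every graph `H` of order at most `t` with two (possibly equal)
distinguished vertices, the number of induced subgraphs of that type over a pair `(x, y)` depends
only on whether `x = y`, `x` and `y` are adjacent, or they are distinct and non-adjacent. -/
def SimpleGraph.SatisfiesVertexCondition {V : Type u} (Γ : SimpleGraph V) (t : ℕ) : Prop :=
  ∀ x y x' y' : V, (x = y ↔ x' = y') → (Γ.Adj x y ↔ Γ.Adj x' y') →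
    ∀ n : ℕ, n ≤ t → ∀ (H : SimpleGraph (Fin n)) (a b : Fin n),
      Γ.typeCount H a b x y = Γ.typeCount H a b x' y'

/-- An incidence structure with point set `P` and line set `L`. -/
structure IncidenceStructure (P : Type u) (L : Type v) where
  /-- `Inc p l`: the point `p` is incident with the line `l`. -/
  Inc : P → L → Prop

namespace IncidenceStructure

variable {P : Type u} {L : Type v}

/-- Two distinct points are collinear if some line is incident with both. -/
def Collinear (I : IncidenceStructure P L) (p q : P) : Prop :=
  p ≠ q ∧ ∃ l : L, I.Inc p l ∧ I.Inc q l

/-- The point graph: two points are adjacent if and only if they are collinear. -/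
def pointGraph (I : IncidenceStructure P L) : SimpleGraph P where
  Adj := I.Collinear
  symm := ⟨fun _ _ h => ⟨h.1.symm, h.2.imp fun _ hl => hl.symm⟩⟩
  loopless := ⟨fun _ h => h.1 rfl⟩

/-- Partial linear spaces of order `(s, t)`. -/
structure IsPartialLinearSpace (I : IncidenceStructure P L) (s t : ℕ) : Prop where
  points_on_line : ∀ l : L, {p : P | I.Inc p l}.ncard = s + 1
  lines_through_point : ∀ p : P, {l : L | I.Inc p l}.ncard = t + 1
  line_unique : ∀ p q : P, p ≠ q → ∀ l m : L,
    I.Inc p l → I.Inc q l → I.Inc p m → I.Inc q m → l = m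

/-- Generalized quadrangles of order `(s, t)`. -/
structure IsGeneralizedQuadrangle (I : IncidenceStructure P L) (s t : ℕ) : Prop
    extends I.IsPartialLinearSpace s t where
  antiflag : ∀ (p : P) (l : L), ¬ I.Inc p l → ∃! q : P, I.Collinear p q ∧ I.Inc q l

/-- Partial quadrangles with parameters `(s, t, μ)`. -/
structure IsPartialQuadrangle (I : IncidenceStructure P L) (s t μ : ℕ) : Prop
    extends I.IsPartialLinearSpace s t where
  no_triangle : ∀ p q r : P, I.Collinear p q → I.Collinear q r → I.Collinear p r →
    ∃ l : L, I.Inc p l ∧ I.Inc q l ∧ I.Inc r l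
  common_neighbors : ∀ p q : P, p ≠ q → ¬ I.Collinear p q →
    {x : P | I.Collinear x p ∧ I.Collinear x q}.ncard = μ

end IncidenceStructure

/-!
Two properties of the point graph `Γ` of a partial quadrangle are used. It is *diamond-free*: two
common neighbours of adjacent points lie on the line through these points, hence are adjacent. And
it is `3`-isoregular, either by hypothesis or, for a generalized quadrangle of order `(q, q²)`,
because every triple of pairwise non-collinear points has exactly `q + 1` common neighbours
(`card_common_triad`, a variance argument), the other configurations of at most three points being
immediate from the definition.

The heart of the proof is `card_placements_pullback_eq`: if `B` is a set of at most three vertices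
of a graph `G` on at most seven vertices, then the number of ways to extend an embedding of `G[B]`
to an induced embedding of `G` in `Γ` does not depend on the embedding of `G[B]`. By induction on
`G` from above, using inclusion-exclusion over supergraphs, it is enough to count the injective
maps preserving the edges of `G`. One may assume that `G` is diamond-free, since otherwise it does
not embed at all. Then some vertex `e` outside `B` can be removed: there are at most three
neighbours `S` of `e` such that every further neighbour is adjacent to both ends of an edge inside
`S` (`exists_dominates`). By diamond-freeness, a vertex off the image of the pattern that is
adjacent to the images of `S` is adjacent to the images of all neighbours of `e`, so that
`3`-isoregularity counts the possible images of `e`, and induction on the number of vertices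
applies.

Finally, an embedding of a graph on at most six vertices in the second subconstituent of `v` is the
same as an embedding in `Γ` of this graph with an additional isolated vertex placed at `v`. With
this vertex and the two distinguished ones as the base `B`, the regularity of patterns on seven
vertices over three becomes the `6`-vertex condition. -/

/-! ### Vertices with a dominating set in small diamond-free graphs -/

/-- Any two common neighbours of the ends of an edge are adjacent: there is no induced `K₄ - e`. -/
def SimpleGraph.IsDiamondFree {V : Type u} (Γ : SimpleGraph V) : Prop :=
  ∀ a b c d : V, Γ.Adj a b → Γ.Adj a c → Γ.Adj b c → Γ.Adj a d → Γ.Adj b d → c ≠ d → Γ.Adj c d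

/-- `S` consists of at most three neighbours of `e`, and every other neighbour of `e` is adjacent
to both ends of some edge inside `S`. In a diamond-free host graph, a vertex adjacent to the image
of `S` and off the image of the pattern is then adjacent to the image of every neighbour of `e`. -/
def SimpleGraph.Dominates {α : Type u} (G : SimpleGraph α) (S : Finset α) (e : α) : Prop :=
  S.card ≤ 3 ∧ (∀ u ∈ S, G.Adj e u) ∧
    ∀ u, G.Adj e u → u ∉ S → ∃ a ∈ S, ∃ b ∈ S, G.Adj a b ∧ G.Adj u a ∧ G.Adj u b

namespace SimpleGraph

open Finset
open scoped Classical

variable {α : Type u} [Fintype α] {G : SimpleGraph α}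

lemma four_le_card_neighborFinset {e : α} (h : ∀ S, ¬ G.Dominates S e) :
    4 ≤ #(G.neighborFinset e) := by
  by_contra hlt
  refine h (G.neighborFinset e) ⟨by omega, fun u hu => by simpa using hu, fun u hu hn => ?_⟩
  simp [hu] at hn

/-- If at most one neighbour of `e` lay outside the clique spanned by `e`, `x` and their common
neighbours, then that neighbour, `x` and one common neighbour would dominate `e`. -/
lemma two_le_card_neighborFinset_sdiff (hG : G.IsDiamondFree) {e x : α}
    (h : ∀ S, ¬ G.Dominates S e) (hx : G.Adj e x) :
    2 ≤ #((G.neighborFinset e \ G.neighborFinset x).erase x) := by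
  by_contra hlt
  have h4 := four_le_card_neighborFinset h
  set R := (G.neighborFinset e \ G.neighborFinset x).erase x with hR
  by_cases hc : ∃ c, G.Adj e c ∧ G.Adj x c
  · obtain ⟨c, hec, hxc⟩ := hc
    refine h (insert x (insert c R)) ⟨?_, ?_, ?_⟩
    · have := card_insert_le x (insert c R)
      have := card_insert_le c R
      omega
    · intro u hu
      simp only [mem_insert, hR, mem_erase, mem_sdiff, mem_neighborFinset] at hu
      rcases hu with rfl | rfl | hu
      exacts [hx, hec, hu.2.1]
    · intro u hu hn
      simp only [mem_insert, hR, mem_erase, mem_sdiff, mem_neighborFinset, not_or, not_and,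
        not_not] at hn
      have hxu : G.Adj x u := hn.2.2 hn.1 hu
      exact ⟨x, by simp, c, by simp, hxc, hxu.symm,
        hG e x u c hx hu hxu hec hxc hn.2.1⟩
  · have : G.neighborFinset e ⊆ insert x R := by
      intro u hu
      simp only [mem_neighborFinset] at hu
      simp only [mem_insert, hR, mem_erase, mem_sdiff, mem_neighborFinset]
      by_cases hux : u = x
      · exact Or.inl hux
      · exact Or.inr ⟨hux, hu, fun hxu => hc ⟨u, hu, hxu⟩⟩
    have := card_le_card this
    have := card_insert_le x R
    omega

/-- On at most seven vertices, adjacent vertices without dominating sets have exactly one common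
neighbour, have degree four, and every vertex is adjacent to one of them. -/
lemma card_inter_of_adj_of_not_dominates (hG : G.IsDiamondFree) {D : Finset α} (hD : #D ≤ 7)
    (hGD : ∀ a b, G.Adj a b → a ∈ D) {e x : α}
    (he : ∀ S, ¬ G.Dominates S e) (hx : ∀ S, ¬ G.Dominates S x) (hex : G.Adj e x) :
    #(G.neighborFinset e ∩ G.neighborFinset x) = 1 ∧ #(G.neighborFinset e) = 4 ∧
      G.neighborFinset e ∪ G.neighborFinset x = D := by
  have h1 := two_le_card_neighborFinset_sdiff hG he hex
  have h2 := two_le_card_neighborFinset_sdiff hG hx hex.symm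
  have h3 := four_le_card_neighborFinset he
  have h4 := four_le_card_neighborFinset hx
  have h5 : G.neighborFinset e ∪ G.neighborFinset x ⊆ D := by
    intro u hu
    simp only [mem_union, mem_neighborFinset] at hu
    rcases hu with hu | hu <;> exact hGD _ _ hu.symm
  have h6 := card_le_card h5
  have h7 := card_union_add_card_inter (G.neighborFinset e) (G.neighborFinset x)
  have h8 := card_inter_add_card_sdiff (G.neighborFinset e) (G.neighborFinset x)
  have h9 := card_inter_add_card_sdiff (G.neighborFinset x) (G.neighborFinset e)
  rw [inter_comm] at h9
  rw [card_erase_of_mem (by simp [hex])] at h1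
  rw [card_erase_of_mem (by simp [hex.symm])] at h2
  exact ⟨by omega, by omega, eq_of_subset_of_card_le h5 (by omega)⟩

/-- In a diamond-free graph on at most seven vertices, at most three of which form the base `B`,
some vertex outside `B` has a dominating set. Otherwise the vertices outside `B` would span a
4-cycle whose edges form triangles with four different vertices of `B`. -/
theorem exists_dominates (hG : G.IsDiamondFree) {B D : Finset α} (hB : #B ≤ 3) (hD : #D ≤ 7)
    (hGD : ∀ a b, G.Adj a b → a ∈ D) (hBD : B ⊂ D) :
    ∃ e ∈ D, e ∉ B ∧ ∃ S, G.Dominates S e := by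
  by_contra hcon
  have hE : ∀ e, e ∈ D → e ∉ B → ∀ S, ¬ G.Dominates S e := fun e h1 h2 S h3 =>
    hcon ⟨e, h1, h2, S, h3⟩
  have key : ∀ {e x}, e ∈ D → e ∉ B → x ∈ D → x ∉ B → G.Adj e x →
      #(G.neighborFinset e ∩ G.neighborFinset x) = 1 ∧ #(G.neighborFinset e) = 4 ∧
      G.neighborFinset e ∪ G.neighborFinset x = D := fun h1 h2 h3 h4 h =>
    card_inter_of_adj_of_not_dominates hG hD hGD (hE _ h1 h2) (hE _ h3 h4) h
  have uniq : ∀ {e x f g}, e ∈ D → e ∉ B → x ∈ D → x ∉ B → G.Adj e x →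
      G.Adj e f → G.Adj x f → G.Adj e g → G.Adj x g → f = g := by
    intro e x f g h1 h2 h3 h4 h hf hf' hg hg'
    exact card_le_one.1 (key h1 h2 h3 h4 h).1.le f (by simp [*]) g (by simp [*])
  have cover : ∀ {e x u}, e ∈ D → e ∉ B → x ∈ D → x ∉ B → G.Adj e x → u ∈ D →
      ¬ G.Adj e u → G.Adj x u := by
    intro e x u h1 h2 h3 h4 h hu hn
    rw [← (key h1 h2 h3 h4 h).2.2] at hu
    simpa [hn] using hu
  -- A third such vertex in a triangle would have degree two.
  have common_mem : ∀ {e x f}, e ∈ D → e ∉ B → x ∈ D → x ∉ B → G.Adj e x →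
      G.Adj e f → G.Adj x f → f ∈ B := by
    intro e x f h1 h2 h3 h4 h hf hf'
    by_contra hfB
    have hfD : f ∈ D := hGD f e hf.symm
    have hsub : G.neighborFinset f ⊆ {e, x} := by
      intro u hu
      simp only [mem_neighborFinset] at hu
      simp only [mem_insert, mem_singleton]
      by_cases heu : G.Adj e u
      · exact Or.inr (uniq h1 h2 hfD hfB hf heu hu h hf'.symm)
      · exact Or.inl (uniq h3 h4 hfD hfB hf' (cover h1 h2 h3 h4 h (hGD u f hu.symm) heu) hu
          h.symm hf.symm)
    have := card_le_card hsub
    have := four_le_card_neighborFinset (hE f hfD hfB)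
    have := card_le_two (a := e) (b := x)
    omega
  have exists_common : ∀ {e x}, e ∈ D → e ∉ B → x ∈ D → x ∉ B → G.Adj e x →
      ∃ f ∈ B, G.Adj e f ∧ G.Adj x f := by
    intro e x h1 h2 h3 h4 h
    obtain ⟨f, hf⟩ := card_pos.1 (by rw [(key h1 h2 h3 h4 h).1]; exact one_pos)
    simp only [mem_inter, mem_neighborFinset] at hf
    exact ⟨f, common_mem h1 h2 h3 h4 h hf.1 hf.2, hf⟩
  -- Distinct edges at `x` outside `B` have distinct third vertices.
  have common_ne : ∀ {x e h f g}, x ∈ D → x ∉ B → e ∈ D → e ∉ B → h ∈ D → h ∉ B → e ≠ h →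
      G.Adj x e → G.Adj x h → G.Adj x f → G.Adj e f → G.Adj x g → G.Adj h g → f ≠ g := by
    rintro x e h f _ hx hx' he he' hh hh' hne hxe hxh hxf hef - hhf rfl
    have : G.Adj e h := hG x f e h hxf hxe hef.symm hxh hhf.symm hne
    exact hh' (common_mem hx hx' he he' hxe hxh this)
  have exists_nbr : ∀ {e}, e ∈ D → e ∉ B → ∃ x ∈ D, x ∉ B ∧ G.Adj e x := by
    intro e he he'
    have h4 := four_le_card_neighborFinset (hE e he he')
    obtain ⟨x, hx, hxB⟩ := exists_mem_notMem_of_card_lt_card (show #B < #(G.neighborFinset e) by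
      omega)
    simp only [mem_neighborFinset] at hx
    exact ⟨x, hGD x e hx.symm, hxB, hx⟩
  -- Three neighbours of `x` outside `B` would give six neighbours in all.
  have no_three : ∀ {x a b c}, x ∈ D → x ∉ B → a ∈ D → a ∉ B → b ∈ D → b ∉ B → c ∈ D → c ∉ B →
      a ≠ b → a ≠ c → b ≠ c → G.Adj x a → G.Adj x b → G.Adj x c → False := by
    intro x a b c hx hx' ha ha' hb hb' hc hc' hab hac hbc hxa hxb hxc
    obtain ⟨f, hfB, hf, hf'⟩ := exists_common hx hx' ha ha' hxa
    obtain ⟨g, hgB, hg, hg'⟩ := exists_common hx hx' hb hb' hxb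
    obtain ⟨k, hkB, hk, hk'⟩ := exists_common hx hx' hc hc' hxc
    have h1 := common_ne hx hx' ha ha' hb hb' hab hxa hxb hf hf' hg hg'
    have h2 := common_ne hx hx' ha ha' hc hc' hac hxa hxc hf hf' hk hk'
    have h3 := common_ne hx hx' hb hb' hc hc' hbc hxb hxc hg hg' hk hk'
    have h5 : #({f, g, k, a, b} : Finset α) = 5 := by
      have n1 : ∀ {u w}, u ∈ B → w ∉ B → u ≠ w := fun hu hw h => hw (h ▸ hu)
      have := n1 hfB ha'
      have := n1 hfB hb'
      have := n1 hgB ha'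
      have := n1 hgB hb'
      have := n1 hkB ha'
      have := n1 hkB hb'
      simp [*]
    have hsub : ({f, g, k, a, b} : Finset α) ⊆ G.neighborFinset x := by
      intro u hu
      simp only [mem_insert, mem_singleton] at hu
      rcases hu with rfl | rfl | rfl | rfl | rfl <;> simpa
    have := card_le_card hsub
    have := (key hx hx' ha ha' hxa).2.1
    omega
  -- Neither end of an edge outside `B` is a leaf there: the other end would be adjacent to
  -- everything else outside `B`.
  have exists_other : ∀ {e x}, e ∈ D → e ∉ B → x ∈ D → x ∉ B → G.Adj e x →
      ∃ g ∈ D, g ∉ B ∧ g ≠ x ∧ G.Adj e g := by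
    intro e x he he' hx hx' hex
    by_contra hno
    have hall : ∀ u, u ∈ D → u ∉ B → u ≠ x → G.Adj x u := fun u hu hu' hux =>
      cover he he' hx hx' hex hu fun h => hno ⟨u, hu, hu', hux, h⟩
    have h7 : #D = 7 := by
      obtain ⟨k1, k2, k3⟩ := key he he' hx hx' hex
      have k4 := (key hx hx' he he' hex.symm).2.1
      have := card_union_add_card_inter (G.neighborFinset e) (G.neighborFinset x)
      rw [k3] at this
      omega
    have hc : 3 ≤ #((D \ B).erase x) := by
      rw [card_erase_of_mem (by simp [hx, hx'])]
      have := le_card_sdiff B D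
      omega
    obtain ⟨T, hT, hT3⟩ := exists_subset_card_eq hc
    obtain ⟨a, b, c, hab, hac, hbc, rfl⟩ := card_eq_three.1 hT3
    have ma := mem_erase.1 (hT (show a ∈ ({a, b, c} : Finset α) by simp))
    have mb := mem_erase.1 (hT (show b ∈ ({a, b, c} : Finset α) by simp))
    have mc := mem_erase.1 (hT (show c ∈ ({a, b, c} : Finset α) by simp))
    simp only [mem_sdiff] at ma mb mc
    exact no_three hx hx' ma.2.1 ma.2.2 mb.2.1 mb.2.2 mc.2.1 mc.2.2 hab hac hbc
      (hall a ma.2.1 ma.2.2 ma.1) (hall b mb.2.1 mb.2.2 mb.1) (hall c mc.2.1 mc.2.2 mc.1)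
  obtain ⟨e, he, he'⟩ := exists_of_ssubset hBD
  obtain ⟨x, hx, hx', hex⟩ := exists_nbr he he'
  obtain ⟨g, hg, hg', hgx, heg⟩ := exists_other he he' hx hx' hex
  obtain ⟨h, hh, hh', hhe, hxh⟩ := exists_other hx hx' he he' hex.symm
  have heh : ¬ G.Adj e h := fun heh => hh' (common_mem he he' hx hx' hex heh hxh)
  have hgh : G.Adj g h := cover he he' hg hg' heg hh heh
  -- The third vertices of the edges of the 4-cycle `e x h g` are four distinct elements of `B`.
  obtain ⟨f₁, hf₁, he₁, hx₁⟩ := exists_common he he' hx hx' hex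
  obtain ⟨f₂, hf₂, hx₂, hh₂⟩ := exists_common hx hx' hh hh' hxh
  obtain ⟨f₃, hf₃, hg₃, hh₃⟩ := exists_common hg hg' hh hh' hgh
  obtain ⟨f₄, hf₄, he₄, hg₄⟩ := exists_common he he' hg hg' heg
  have n12 : f₁ ≠ f₂ := common_ne hx hx' he he' hh hh' hhe.symm hex.symm hxh hx₁ he₁ hx₂ hh₂
  have hxg : x ≠ g := hgx.symm
  have n23 : f₂ ≠ f₃ := common_ne hh hh' hx hx' hg hg' hxg hxh.symm hgh.symm hh₂ hx₂ hh₃ hg₃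
  have n34 : f₃ ≠ f₄ := common_ne hg hg' hh hh' he he' hhe hgh heg.symm hg₃ hh₃ hg₄ he₄
  have n14 : f₁ ≠ f₄ := common_ne he he' hx hx' hg hg' hxg hex heg he₁ hx₁ he₄ hg₄
  have n13 : f₁ ≠ f₃ := by
    rintro rfl
    exact n12 (uniq hx hx' hh hh' hxh hx₁ hh₃ hx₂ hh₂)
  have n24 : f₂ ≠ f₄ := by
    rintro rfl
    exact n12 (uniq he he' hx hx' hex he₁ hx₁ he₄ hx₂)
  have h4 : #({f₁, f₂, f₃, f₄} : Finset α) = 4 := by simp [*]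
  have hsub : ({f₁, f₂, f₃, f₄} : Finset α) ⊆ B := by
    intro u hu
    simp only [mem_insert, mem_singleton] at hu
    rcases hu with rfl | rfl | rfl | rfl <;> assumption
  have := card_le_card hsub
  omega

end SimpleGraph

/-! ### Regularity of patterns on seven vertices over three -/

namespace SimpleGraph

open Finset
open scoped Classical

variable {V : Type u} {α : Type v}

/-- The graph on `α` whose edges are the pairs in `D` that `f` maps to edges of `Γ`. -/
def pullback (Γ : SimpleGraph V) (D : Finset α) (f : α → V) : SimpleGraph α where
  Adj a b := a ∈ D ∧ b ∈ D ∧ Γ.Adj (f a) (f b)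
  symm := ⟨fun _ _ h => ⟨h.2.1, h.1, h.2.2.symm⟩⟩
  loopless := ⟨fun _ h => h.2.2.ne rfl⟩

lemma pullback_adj {Γ : SimpleGraph V} {D : Finset α} {f : α → V} {a b : α} :
    (Γ.pullback D f).Adj a b ↔ a ∈ D ∧ b ∈ D ∧ Γ.Adj (f a) (f b) := Iff.rfl

lemma adj_iff_of_pullback_eq {Γ : SimpleGraph V} {D : Finset α} {f f' : α → V}
    (h : Γ.pullback D f = Γ.pullback D f') {a b : α} (ha : a ∈ D) (hb : b ∈ D) :
    Γ.Adj (f a) (f b) ↔ Γ.Adj (f' a) (f' b) := by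
  have : (Γ.pullback D f).Adj a b ↔ (Γ.pullback D f').Adj a b := by rw [h]
  simpa [pullback_adj, ha, hb] using this

lemma IsDiamondFree.pullback {Γ : SimpleGraph V} (hΓ : Γ.IsDiamondFree) {D : Finset α}
    {f : α → V} (hf : Set.InjOn f D) : (Γ.pullback D f).IsDiamondFree :=
  fun _ _ _ _ hab hac hbc had hbd hcd =>
    ⟨hac.2.1, had.2.1, hΓ _ _ _ _ hab.2.2 hac.2.2 hbc.2.2 had.2.2 hbd.2.2
      fun h => hcd (hf hac.2.1 had.2.1 h)⟩

/-- In a `k`-isoregular graph, injective images of a set of at most `k` points with the same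
pulled-back graph have equally many common neighbours. -/
lemma IsIsoregular.card_common_neighbors_eq [Fintype V] {Γ : SimpleGraph V} {k : ℕ}
    (hk : Γ.IsIsoregular k) {S : Finset α} (hS : #S ≤ k) {f f' : α → V} (hf : Set.InjOn f S)
    (hf' : Set.InjOn f' S)
    (h : ∀ a ∈ S, ∀ b ∈ S, (Γ.Adj (f a) (f b) ↔ Γ.Adj (f' a) (f' b))) :
    #{w | ∀ u ∈ S, Γ.Adj w (f u)} = #{w | ∀ u ∈ S, Γ.Adj w (f' u)} := by
  have himg : ∀ g : α → V, {w : V | w ∉ S.image g ∧ ∀ x ∈ S.image g, Γ.Adj w x}.ncard =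
      #{w | ∀ u ∈ S, Γ.Adj w (g u)} := by
    intro g
    rw [← Set.ncard_coe_finset]
    congr 1
    ext w
    simp only [mem_image, not_exists, not_and, forall_exists_index, and_imp,
      forall_apply_eq_imp_iff₂, Set.mem_ofPred_eq, coe_filter, mem_univ, true_and,
      and_iff_right_iff_imp]
    exact fun hw u hu huw => (hw u hu).ne huw.symm
  have e1 : ∀ g : α → V, Set.InjOn g S → Nonempty
      ((Γ.comap fun u : (S : Set α) => g u) ≃g Γ.induce ((S.image g : Finset V) : Set V)) := by
    intro g hg
    rw [coe_image]
    exact ⟨⟨Equiv.Set.imageOfInjOn g S hg, by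
      intro a b; simp [Equiv.Set.imageOfInjOn]⟩⟩
  obtain ⟨φ⟩ := e1 f hf
  obtain ⟨ψ⟩ := e1 f' hf'
  have hcomap : (Γ.comap fun u : (S : Set α) => f u) = Γ.comap fun u : (S : Set α) => f' u := by
    ext a b
    exact h a a.2 b b.2
  rw [hcomap] at φ
  have := hk (S.image f) (S.image f') (card_image_le.trans hS) (card_image_le.trans hS)
    ⟨φ.symm.trans ψ⟩
  rwa [himg, himg] at this

/-- The number of ways to extend a placement of a pattern by one vertex with a dominating set
depends only on the graph pulled back along the placement. -/
lemma card_extensions_eq [Fintype V] {Γ : SimpleGraph V} (hΓ : Γ.IsDiamondFree)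
    (h3 : Γ.IsIsoregular 3) {G : SimpleGraph α} {D S : Finset α} {e : α}
    (hS : G.Dominates S e) (hD : ∀ u, G.Adj e u → u ∈ D) {f f' : α → V}
    (hf : Set.InjOn f D) (hf' : Set.InjOn f' D) (h : Γ.pullback D f = Γ.pullback D f')
    (hG : ∀ a ∈ D, ∀ b ∈ D, G.Adj a b → Γ.Adj (f a) (f b)) :
    #{w | (∀ a ∈ D, f a ≠ w) ∧ ∀ u, G.Adj e u → Γ.Adj w (f u)} =
      #{w | (∀ a ∈ D, f' a ≠ w) ∧ ∀ u, G.Adj e u → Γ.Adj w (f' u)} := by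
  have hSD : S ⊆ D := fun u hu => hD u (hS.2.1 u hu)
  have aux : ∀ g : α → V, Set.InjOn g D →
      (∀ a ∈ D, ∀ b ∈ D, G.Adj a b → Γ.Adj (g a) (g b)) →
      #{w | (∀ a ∈ D, g a ≠ w) ∧ ∀ u, G.Adj e u → Γ.Adj w (g u)} +
        #{a ∈ D | ∀ u ∈ S, Γ.Adj (g a) (g u)} = #{w | ∀ u ∈ S, Γ.Adj w (g u)} := by
    intro g hg hgG
    rw [← card_filter_add_card_filter_not (s := {w | ∀ u ∈ S, Γ.Adj w (g u)})
      (fun w => ∀ a ∈ D, g a ≠ w)]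
    congr 1
    · congr 1
      ext w
      simp only [mem_filter, mem_univ, true_and]
      refine ⟨fun hw => ⟨fun u hu => hw.2 u (hS.2.1 u hu), hw.1⟩, fun hw => ⟨hw.2, ?_⟩⟩
      intro u hu
      by_cases huS : u ∈ S
      · exact hw.1 u huS
      · obtain ⟨a, ha, b, hb, hab, hua, hub⟩ := hS.2.2 u hu huS
        have haD := hSD ha
        have hbD := hSD hb
        exact (hΓ (g a) (g b) (g u) w (hgG a haD b hbD hab)
          (hgG u (hD u hu) a haD hua).symm (hgG u (hD u hu) b hbD hub).symm
          (hw.1 a ha).symm (hw.1 b hb).symm (hw.2 u (hD u hu))).symm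
    · rw [← card_image_of_injOn (s := {a ∈ D | ∀ u ∈ S, Γ.Adj (g a) (g u)}) (f := g)
        (hg.mono fun a ha => (mem_filter.1 ha).1)]
      congr 1
      ext w
      simp only [mem_image, mem_filter, mem_univ, true_and]
      constructor
      · rintro ⟨a, ⟨ha, hau⟩, rfl⟩
        exact ⟨hau, fun hn => hn a ha rfl⟩
      · rintro ⟨hw, hn⟩
        push Not at hn
        obtain ⟨a, ha, rfl⟩ := hn
        exact ⟨a, ⟨ha, hw⟩, rfl⟩
  have hG' : ∀ a ∈ D, ∀ b ∈ D, G.Adj a b → Γ.Adj (f' a) (f' b) := fun a ha b hb hab =>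
    (adj_iff_of_pullback_eq h ha hb).1 (hG a ha b hb hab)
  have a1 := aux f hf hG
  have a2 := aux f' hf' hG'
  have a3 := h3.card_common_neighbors_eq hS.1 (hf.mono (coe_subset.2 hSD))
    (hf'.mono (coe_subset.2 hSD))
    (fun a ha b hb => adj_iff_of_pullback_eq h (hSD ha) (hSD hb))
  have a4 : #{a ∈ D | ∀ u ∈ S, Γ.Adj (f a) (f u)} = #{a ∈ D | ∀ u ∈ S, Γ.Adj (f' a) (f' u)} := by
    congr 1
    refine filter_congr fun a ha => forall₂_congr fun u hu => ?_
    exact adj_iff_of_pullback_eq h ha (hSD hu)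
  omega

lemma sum_eq_sum_of_card_fiber_eq {ι κ : Type*} [Fintype κ] {A A' : Finset ι}
    {T : ι → κ} (h : ∀ k, #{f ∈ A | T f = k} = #{f ∈ A' | T f = k}) {F : ι → ℕ}
    (hF : ∀ f ∈ A, ∀ f' ∈ A', T f = T f' → F f = F f') : ∑ f ∈ A, F f = ∑ f ∈ A', F f := by
  rw [← sum_fiberwise A T F, ← sum_fiberwise A' T F]
  refine sum_congr rfl fun k _ => ?_
  rcases {f ∈ A' | T f = k}.eq_empty_or_nonempty with he | ⟨f', hf'⟩
  · have h0 := h k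
    rw [he, card_empty, card_eq_zero] at h0
    rw [he, h0]
  · rw [mem_filter] at hf'
    have hc : ∀ f ∈ ({f ∈ A | T f = k} : Finset ι), F f = F f' := fun f hf => by
      rw [mem_filter] at hf
      exact hF f hf.1 f' hf'.1 (hf.2.trans hf'.2.symm)
    have hne : 0 < #{f ∈ A | T f = k} := by
      rw [h k]; exact card_pos.2 ⟨f', by simpa using hf'⟩
    obtain ⟨f, hf⟩ := card_pos.1 hne
    have hc' : ∀ g ∈ ({f ∈ A' | T f = k} : Finset ι), F g = F f' := fun g hg => by
      rw [← hc f hf]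
      rw [mem_filter] at hf hg
      exact (hF f hf.1 g hg.1 (hf.2.trans hg.2.symm)).symm
    rw [sum_congr rfl hc, sum_congr rfl hc', sum_const, sum_const, h k]

lemma le_pullback_update_iff {Γ : SimpleGraph V} {G : SimpleGraph α} {D : Finset α}
    (hGD : ∀ a b, G.Adj a b → a ∈ D) (e : α) (f : α → V) (w : V) :
    G ≤ Γ.pullback D (Function.update f e w) ↔
      (∀ a ∈ D.erase e, ∀ b ∈ D.erase e, G.Adj a b → Γ.Adj (f a) (f b)) ∧
        ∀ u, G.Adj e u → Γ.Adj w (f u) := by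
  constructor
  · intro h
    refine ⟨fun a ha b hb hab => ?_, fun u hu => ?_⟩
    · have := (h hab).2.2
      rwa [Function.update_of_ne (mem_erase.1 ha).1, Function.update_of_ne (mem_erase.1 hb).1]
        at this
    · have := (h hu).2.2
      rwa [Function.update_self, Function.update_of_ne hu.ne'] at this
  · rintro ⟨h1, h2⟩ a b hab
    have ha := hGD a b hab
    have hb := hGD b a hab.symm
    refine ⟨ha, hb, ?_⟩
    by_cases hae : a = e
    · subst hae
      rw [Function.update_self, Function.update_of_ne hab.ne']
      exact h2 b hab
    · by_cases hbe : b = e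
      · subst hbe
        rw [Function.update_self, Function.update_of_ne hae]
        exact (h2 a hab.symm).symm
      · rw [Function.update_of_ne hae, Function.update_of_ne hbe]
        exact h1 a (mem_erase.2 ⟨hae, ha⟩) b (mem_erase.2 ⟨hbe, hb⟩) hab

variable [Fintype V] [Fintype α]

/-- The maps that are injective on `D` and agree with `f₀` on `B`. They are normalised to agree
with `f₀` off `D` too, so that each injection of `D` is counted once. -/
noncomputable def placements (B D : Finset α) (f₀ : α → V) : Finset (α → V) :=
  {f | (∀ a, (a ∈ D → a ∈ B) → f a = f₀ a) ∧ Set.InjOn f D}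

lemma mem_placements {B D : Finset α} {f₀ f : α → V} :
    f ∈ placements B D f₀ ↔ (∀ a, (a ∈ D → a ∈ B) → f a = f₀ a) ∧ Set.InjOn f D := by
  simp [placements]

/-- Placements of `D` that map the edges of `G` to edges are counted by summing, over the
placements of `D` without `e`, the number of admissible images of `e`. -/
lemma card_placements_eq_sum {Γ : SimpleGraph V} {G : SimpleGraph α} {B D : Finset α}
    {e : α} (heD : e ∈ D) (heB : e ∉ B) (f₀ : α → V) :
    #{f ∈ placements B D f₀ | G ≤ Γ.pullback D f} =
      ∑ f ∈ placements B (D.erase e) f₀,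
        #{w | (∀ a ∈ D.erase e, f a ≠ w) ∧ G ≤ Γ.pullback D (Function.update f e w)} := by
  rw [card_eq_sum_card_fiberwise (f := fun g => Function.update g e (f₀ e))
    (t := placements B (D.erase e) f₀)]
  · refine sum_congr rfl fun f hf => ?_
    rw [mem_placements] at hf
    have hfe : f e = f₀ e := hf.1 e fun h => absurd rfl (mem_erase.1 h).1
    symm
    refine card_nbij' (fun w => Function.update f e w) (fun g => g e) ?_ ?_ ?_ ?_
    · intro w hw
      simp only [coe_filter, mem_univ, true_and, Set.mem_ofPred_eq] at hw
      simp only [coe_filter, mem_filter, mem_placements, Set.mem_ofPred_eq]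
      refine ⟨⟨⟨fun a ha => ?_, ?_⟩, hw.2⟩, ?_⟩
      · have hae : a ≠ e := fun h => heB (h ▸ ha (h ▸ heD))
        rw [Function.update_of_ne hae]
        exact hf.1 a fun h => ha (mem_of_mem_erase h)
      · intro a ha b hb hab
        by_cases hae : a = e <;> by_cases hbe : b = e
        · rw [hae, hbe]
        · rw [hae, Function.update_self, Function.update_of_ne hbe] at hab
          exact absurd hab.symm (hw.1 b (mem_erase.2 ⟨hbe, hb⟩))
        · rw [hbe, Function.update_self, Function.update_of_ne hae] at hab
          exact absurd hab (hw.1 a (mem_erase.2 ⟨hae, ha⟩))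
        · rw [Function.update_of_ne hae, Function.update_of_ne hbe] at hab
          exact hf.2 (mem_coe.2 (mem_erase.2 ⟨hae, ha⟩)) (mem_coe.2 (mem_erase.2 ⟨hbe, hb⟩)) hab
      · rw [Function.update_idem, ← hfe, Function.update_eq_self]
    · intro g hg
      simp only [coe_filter, mem_filter, mem_placements, Set.mem_ofPred_eq] at hg
      obtain ⟨⟨⟨hg1, hg2⟩, hg3⟩, rfl⟩ := hg
      simp only [coe_filter, mem_univ, true_and, Set.mem_ofPred_eq, Function.update_idem,
        Function.update_eq_self]
      refine ⟨fun a ha hae => ?_, hg3⟩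
      rw [mem_erase] at ha
      rw [Function.update_of_ne ha.1] at hae
      exact ha.1 (hg2 ha.2 heD hae)
    · intro w _
      simp
    · intro g hg
      simp only [coe_filter, mem_filter, Set.mem_ofPred_eq] at hg
      simp [← hg.2]
  · intro g hg
    simp only [coe_filter, mem_placements, Set.mem_ofPred_eq] at hg
    simp only [mem_coe, mem_placements]
    refine ⟨fun a ha => ?_, fun a ha b hb hab => ?_⟩
    · by_cases hae : a = e
      · rw [hae, Function.update_self]
      · rw [Function.update_of_ne hae]
        exact hg.1.1 a fun h => ha (mem_erase.2 ⟨hae, h⟩)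
    · rw [mem_coe, mem_erase] at ha hb
      rw [Function.update_of_ne ha.1, Function.update_of_ne hb.1] at hab
      exact hg.1.2 ha.2 hb.2 hab

/-- Regularity of patterns on at most seven vertices over at most three of them: in a
diamond-free `3`-isoregular graph, the number of placements of `D` extending a given injection of
`B` and inducing a given graph depends only on the graph induced by that injection. -/
theorem card_placements_pullback_eq {Γ : SimpleGraph V} (hΓ : Γ.IsDiamondFree)
    (h3 : Γ.IsIsoregular 3) {B : Finset α} (hB : #B ≤ 3) {f₀ f₁ : α → V}
    (hf₀ : Set.InjOn f₀ B) (hf₁ : Set.InjOn f₁ B) (h01 : Γ.pullback B f₀ = Γ.pullback B f₁)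
    (D : Finset α) (hBD : B ⊆ D) (hD : #D ≤ 7) (G : SimpleGraph α) :
    #{f ∈ placements B D f₀ | Γ.pullback D f = G} =
      #{f ∈ placements B D f₁ | Γ.pullback D f = G} := by
  induction hn : #D generalizing D G with
  | zero =>
    obtain rfl := card_eq_zero.1 hn
    obtain rfl : B = ∅ := subset_empty.1 hBD
    have : ∀ g : α → V, placements ∅ ∅ g = {g} := fun g => by
      ext f; simp [mem_placements, funext_iff]
    rw [this, this, filter_singleton, filter_singleton]
    have h : Γ.pullback ∅ f₀ = Γ.pullback ∅ f₁ := h01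
    rw [h]; split_ifs <;> simp
  | succ n ih =>
    rcases hBD.eq_or_ssubset with rfl | hss
    · have : ∀ g : α → V, Set.InjOn g B → placements B B g = {g} := fun g hg => by
        ext f
        simp only [mem_placements, mem_singleton, imp_self, forall_const, ← funext_iff]
        exact ⟨fun h => h.1, fun h => ⟨h, h ▸ hg⟩⟩
      rw [this _ hf₀, this _ hf₁, filter_singleton, filter_singleton, h01]
      split_ifs <;> simp
    -- Induct downwards on `G`, so that the counts for the proper supergraphs of `G` are known.
    induction G using WellFoundedGT.induction with
    | ind G ihG =>
    have hzero : ∀ g : α → V, (¬ ∃ f, Set.InjOn f D ∧ Γ.pullback D f = G) →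
        #{f ∈ placements B D g | Γ.pullback D f = G} = 0 := fun g h => by
      rw [card_eq_zero, filter_eq_empty_iff]
      exact fun f hf hfG => h ⟨f, (mem_placements.1 hf).2, hfG⟩
    by_cases hex : ∃ f, Set.InjOn f D ∧ Γ.pullback D f = G
    swap
    · rw [hzero _ hex, hzero _ hex]
    obtain ⟨f, hf, hfG⟩ := hex
    have hGdf : G.IsDiamondFree := hfG ▸ hΓ.pullback hf
    have hGD : ∀ a b, G.Adj a b → a ∈ D := fun a b hab => by
      rw [← hfG] at hab; exact hab.1
    obtain ⟨e, heD, heB, S, hS⟩ := exists_dominates hGdf hB hD hGD hss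
    -- Removing `e` shows that edge-preserving placements are equinumerous.
    have hN : #{f ∈ placements B D f₀ | G ≤ Γ.pullback D f} =
        #{f ∈ placements B D f₁ | G ≤ Γ.pullback D f} := by
      rw [card_placements_eq_sum heD heB, card_placements_eq_sum heD heB]
      have hsub : B ⊆ D.erase e := fun b hb =>
        mem_erase.2 ⟨fun h => heB (h ▸ hb), hBD hb⟩
      have hcard : #(D.erase e) = n := by rw [card_erase_of_mem heD]; omega
      refine sum_eq_sum_of_card_fiber_eq (T := fun f => Γ.pullback (D.erase e) f)
        (F := fun f => #{w | (∀ a ∈ D.erase e, f a ≠ w) ∧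
          G ≤ Γ.pullback D (Function.update f e w)})
        (fun k => ih (D.erase e) hsub (by omega) k hcard) ?_
      intro f hf f' hf' hff'
      simp only [le_pullback_update_iff hGD]
      by_cases hfe : ∀ a ∈ D.erase e, ∀ b ∈ D.erase e, G.Adj a b → Γ.Adj (f a) (f b)
      · have hfe' : ∀ a ∈ D.erase e, ∀ b ∈ D.erase e, G.Adj a b → Γ.Adj (f' a) (f' b) :=
          fun a ha b hb hab => (adj_iff_of_pullback_eq hff' ha hb).1 (hfe a ha b hb hab)
        simp only [eq_true hfe, eq_true hfe', true_and]
        convert card_extensions_eq hΓ h3 hS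
          (fun u hu => mem_erase.2 ⟨hu.ne', hGD u e hu.symm⟩)
          (mem_placements.1 hf).2 (mem_placements.1 hf').2 hff' hfe
      · have hfe' : ¬ ∀ a ∈ D.erase e, ∀ b ∈ D.erase e, G.Adj a b → Γ.Adj (f' a) (f' b) :=
          fun h => hfe fun a ha b hb hab => (adj_iff_of_pullback_eq hff' ha hb).2 (h a ha b hb hab)
        simp only [eq_false hfe, eq_false hfe', false_and, and_false]
    -- They split according to the supergraph of `G` that they induce.
    have hsplit : ∀ g : α → V, #{f ∈ placements B D g | G ≤ Γ.pullback D f} =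
        #{f ∈ placements B D g | Γ.pullback D f = G} +
          ∑ G' with G < G', #{f ∈ placements B D g | Γ.pullback D f = G'} := by
      intro g
      rw [card_eq_sum_card_fiberwise (f := fun f => Γ.pullback D f) (t := {G' | G ≤ G'})
        (fun f hf => by simpa using (mem_filter.1 hf).2)]
      have : (univ.filter fun G' => G ≤ G') = insert G (univ.filter fun G' => G < G') := by
        ext G'
        simp [le_iff_eq_or_lt, eq_comm]
      rw [this, sum_insert (by simp)]
      have hfib : ∀ G', G ≤ G' → #{f ∈ {f ∈ placements B D g | G ≤ Γ.pullback D f} |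
          Γ.pullback D f = G'} = #{f ∈ placements B D g | Γ.pullback D f = G'} := by
        intro G' hG'
        rw [filter_filter]
        congr 1
        exact filter_congr fun f _ => ⟨fun h => h.2, fun h => ⟨h ▸ hG', h⟩⟩
      rw [hfib G le_rfl]
      congr 1
      exact sum_congr rfl fun G' hG' => hfib G' (by simpa using (mem_filter.1 hG').2.le)
    rw [hsplit, hsplit, sum_congr rfl fun G' hG' => ihG G' (mem_filter.1 hG').2] at hN
    exact Nat.add_right_cancel hN

end SimpleGraph

/-! ### The vertex condition for second subconstituents -/

namespace SimpleGraph

open Finset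
open scoped Classical

/-- Each subgraph of the given type is the image of as many embeddings of `H` as there are
automorphisms of `H` fixing the distinguished vertices. -/
lemma typeCount_mul_card_aut {V : Type u} (Γ : SimpleGraph V) {n : ℕ}
    (H : SimpleGraph (Fin n)) (a b : Fin n) (x y : V) :
    Γ.typeCount H a b x y * Nat.card {σ : H ≃g H // σ a = a ∧ σ b = b} =
      Nat.card {g : H ↪g Γ // g a = x ∧ g b = y} := by
  rw [typeCount, ← Nat.card_coe_set_eq, ← Nat.card_prod]
  set 𝒮 := {S : Set V | ∃ (hx : x ∈ S) (hy : y ∈ S) (φ : Γ.induce S ≃g H),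
    φ ⟨x, hx⟩ = a ∧ φ ⟨y, hy⟩ = b}
  have hx : ∀ S : 𝒮, x ∈ S.1 := fun S => S.2.choose
  have hy : ∀ S : 𝒮, y ∈ S.1 := fun S => S.2.choose_spec.choose
  have hφ : ∀ S : 𝒮, ∃ φ : Γ.induce S.1 ≃g H, φ ⟨x, hx S⟩ = a ∧ φ ⟨y, hy S⟩ = b :=
    fun S => S.2.choose_spec.choose_spec
  choose φ hφa hφb using hφ
  have h1 : ∀ S, (φ S).symm a = ⟨x, hx S⟩ := fun S => by
    rw [RelIso.symm_apply_eq, hφa S]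
  have h2 : ∀ S, (φ S).symm b = ⟨y, hy S⟩ := fun S => by
    rw [RelIso.symm_apply_eq, hφb S]
  let F : 𝒮 × {σ : H ≃g H // σ a = a ∧ σ b = b} → {g : H ↪g Γ // g a = x ∧ g b = y} :=
    fun p => ⟨(Embedding.induce p.1.1).comp (p.2.1.trans (φ p.1).symm).toRelEmbedding, by
      change ((φ p.1).symm (p.2.1 a)).1 = x ∧ ((φ p.1).symm (p.2.1 b)).1 = y
      rw [p.2.2.1, p.2.2.2, h1, h2]
      exact ⟨rfl, rfl⟩⟩
  have hF : ∀ p i, (F p).1 i = ((φ p.1).symm (p.2.1 i)).1 := fun _ _ => rfl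
  have hrange : ∀ p, Set.range (F p).1 = p.1.1 := by
    intro p
    ext w
    constructor
    · rintro ⟨i, rfl⟩
      exact ((φ p.1).symm (p.2.1 i)).2
    · intro hw
      exact ⟨p.2.1.symm (φ p.1 ⟨w, hw⟩), by rw [hF]; simp⟩
  refine Nat.card_congr (Equiv.ofBijective F ⟨?_, ?_⟩)
  · rintro ⟨S, σ⟩ ⟨S', σ'⟩ h
    obtain rfl : S = S' := Subtype.ext (by rw [← hrange ⟨S, σ⟩, ← hrange ⟨S', σ'⟩, h])
    congr 1
    refine Subtype.ext (RelIso.ext fun i => ?_)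
    have := congrArg (fun g => g.1 i) h
    simp only [hF] at this
    exact (φ S).symm.injective (Subtype.ext this)
  · rintro ⟨g, hga, hgb⟩
    let e : H ≃g Γ.induce (Set.range g) :=
      ⟨Equiv.ofInjective g g.injective, fun {i j} => g.map_adj_iff⟩
    have he : ∀ i, (e i).1 = g i := fun _ => rfl
    have hxe : e a = ⟨x, a, hga⟩ := Subtype.ext hga
    have hye : e b = ⟨y, b, hgb⟩ := Subtype.ext hgb
    let S : 𝒮 := ⟨Set.range g, ⟨a, hga⟩, ⟨b, hgb⟩, e.symm, by rw [← hxe]; simp,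
      by rw [← hye]; simp⟩
    refine ⟨⟨S, e.trans (φ S), ?_, ?_⟩, ?_⟩
    · change φ S (e a) = a
      rw [hxe, hφa S]
    · change φ S (e b) = b
      rw [hye, hφb S]
    · refine Subtype.ext (RelEmbedding.ext fun i => ?_)
      rw [hF]
      change ((φ S).symm (φ S (e i))).1 = g i
      simp [he]

lemma typeCount_eq_of_card_embedding_eq {V : Type u} (Γ : SimpleGraph V) {n : ℕ}
    (H : SimpleGraph (Fin n)) (a b : Fin n) {x y x' y' : V}
    (h : Nat.card {g : H ↪g Γ // g a = x ∧ g b = y} =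
      Nat.card {g : H ↪g Γ // g a = x' ∧ g b = y'}) :
    Γ.typeCount H a b x y = Γ.typeCount H a b x' y' := by
  rw [← typeCount_mul_card_aut, ← typeCount_mul_card_aut] at h
  have : Finite (H ≃g H) := Finite.of_injective (fun σ : H ≃g H => (σ : Fin n → Fin n))
    DFunLike.coe_injective
  have : Nonempty {σ : H ≃g H // σ a = a ∧ σ b = b} := ⟨⟨RelIso.refl _, rfl, rfl⟩⟩
  exact Nat.eq_of_mul_eq_mul_right Nat.card_pos h

variable {V : Type u} [Fintype V]

/-- The base map for the pattern consisting of an isolated vertex `none`, placed at `v`, and the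
vertices of `H`, of which `a` is placed at `x` and the others provisionally at `y`. -/
noncomputable def basePlacement {n : ℕ} (a : Fin n) (v x y : V) : Option (Fin n) → V :=
  fun o => o.elim v fun i => if i = a then x else y

/-- Embeddings into the second subconstituent of `v` are placements of the pattern with an
additional isolated vertex lying over `v`. -/
lemma card_embedding_secondSubconstituent (Γ : SimpleGraph V) {n : ℕ} (H : SimpleGraph (Fin n))
    (a b : Fin n) (v : V) (x y : ({w : V | w ≠ v ∧ ¬ Γ.Adj v w} : Set V)) (h : a = b ↔ x = y) :
    Nat.card {g : H ↪g Γ.secondSubconstituent v // g a = x ∧ g b = y} =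
      #{f ∈ placements {none, some a, some b} univ (basePlacement a v x.1 y.1) |
        Γ.pullback univ f = H.map Function.Embedding.some} := by
  have hsome : ∀ i j, (H.map Function.Embedding.some).Adj (some i) (some j) ↔ H.Adj i j :=
    fun i j => map_adj_apply (f := Function.Embedding.some)
  have hnone : ∀ p, ¬ (H.map Function.Embedding.some).Adj none p := by
    intro p hp
    obtain ⟨i, j, -, hi, -⟩ := (map_adj _ _ _ _).1 hp
    exact Option.some_ne_none i hi
  have hbase_b : basePlacement a v x.1 y.1 (some b) = y.1 := by
    by_cases hba : b = a
    · simp [basePlacement, hba, h.1 hba.symm]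
    · simp [basePlacement, hba]
  have hbase_a : basePlacement a v x.1 y.1 (some a) = x.1 := by simp [basePlacement]
  have hbase : basePlacement a v x.1 y.1 none = v := rfl
  have hmem : ∀ f : Option (Fin n) → V,
      f ∈ ({f ∈ placements {none, some a, some b} univ (basePlacement a v x.1 y.1) |
        Γ.pullback univ f = H.map Function.Embedding.some} : Finset _) ↔
      (f none = v ∧ f (some a) = x.1 ∧ f (some b) = y.1) ∧ Function.Injective f ∧
        Γ.pullback univ f = H.map Function.Embedding.some := by
    intro f
    simp only [mem_filter, mem_placements, mem_univ, forall_const, mem_insert, mem_singleton,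
      forall_eq_or_imp, forall_eq, hbase, hbase_a, hbase_b, coe_univ, Set.injOn_univ, and_assoc]
  rw [← Nat.card_eq_finsetCard]
  let Ψ : {g : H ↪g Γ.secondSubconstituent v // g a = x ∧ g b = y} →
      ({f ∈ placements {none, some a, some b} univ (basePlacement a v x.1 y.1) |
        Γ.pullback univ f = H.map Function.Embedding.some} : Finset _) :=
    fun g => ⟨fun o => o.elim v fun i => (g.1 i).1, by
      rw [hmem]
      refine ⟨⟨rfl, congrArg Subtype.val g.2.1, congrArg Subtype.val g.2.2⟩, ?_, ?_⟩
      · rintro (_ | i) (_ | j) hij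
        · rfl
        · exact absurd hij.symm (g.1 j).2.1
        · exact absurd hij (g.1 i).2.1
        · exact congrArg some (g.1.injective (Subtype.ext hij))
      · ext o p
        have hg : ∀ i j, Γ.Adj (g.1 i).1 (g.1 j).1 ↔ H.Adj i j := fun i j => g.1.map_adj_iff
        have hn : ∀ i, ¬ Γ.Adj v (g.1 i).1 := fun i => (g.1 i).2.2
        rcases o with _ | i <;> rcases p with _ | j
        · exact iff_of_false (SimpleGraph.irrefl _) (hnone _)
        · exact iff_of_false (fun h => hn j h.2.2) (hnone _)
        · exact iff_of_false (fun h => hn i h.2.2.symm) fun h => hnone _ h.symm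
        · rw [hsome, ← hg]
          simp [pullback_adj]⟩
  refine Nat.card_congr (Equiv.ofBijective Ψ ⟨?_, ?_⟩)
  · intro g g' hgg
    refine Subtype.ext (RelEmbedding.ext fun i => Subtype.ext ?_)
    exact congrFun (congrArg Subtype.val hgg) (some i)
  · rintro ⟨f, hf⟩
    rw [hmem] at hf
    obtain ⟨⟨hv, hfa, hfb⟩, hinj, hpull⟩ := hf
    have hadj : ∀ o p, Γ.Adj (f o) (f p) ↔ (H.map Function.Embedding.some).Adj o p := by
      intro o p
      rw [← hpull]
      simp [pullback_adj]
    let g : H ↪g Γ.secondSubconstituent v :=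
      ⟨⟨fun i => ⟨f (some i), by
          rw [← hv]
          exact ⟨fun h => by simpa using hinj h, fun h => hnone _ ((hadj _ _).1 h)⟩⟩,
        fun i j hij => Option.some_injective _ (hinj (congrArg Subtype.val hij))⟩,
        fun {i j} => (hadj (some i) (some j)).trans (hsome i j)⟩
    refine ⟨⟨g, Subtype.ext hfa, Subtype.ext hfb⟩, Subtype.ext (funext fun o => ?_)⟩
    rcases o with _ | i
    · exact hv.symm
    · rfl

/-- The graph induced on `v`, `x`, `y` is the same as that on `v`, `x'`, `y'`, so patterns on at
most seven vertices have equally many placements over both triples. -/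
theorem secondSubconstituent_satisfiesVertexCondition {Γ : SimpleGraph V}
    (hΓ : Γ.IsDiamondFree) (h3 : Γ.IsIsoregular 3) (v : V) :
    (Γ.secondSubconstituent v).SatisfiesVertexCondition 6 := by
  intro x y x' y' heq hadj n hn H a b
  apply typeCount_eq_of_card_embedding_eq
  by_cases hab : a = b ↔ x = y
  · have hab' : a = b ↔ x' = y' := hab.trans heq
    rw [card_embedding_secondSubconstituent Γ H a b v x y hab,
      card_embedding_secondSubconstituent Γ H a b v x' y' hab']
    have hinj : ∀ z w : ({w : V | w ≠ v ∧ ¬ Γ.Adj v w} : Set V), (a = b ↔ z = w) →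
        Set.InjOn (basePlacement a v z.1 w.1)
          ({none, some a, some b} : Finset (Option (Fin n))) := by
      intro z w hzw o ho p hp hop
      have hz := z.2.1
      have hw := w.2.1
      have hne : a ≠ b → z.1 ≠ w.1 := fun h h' => h (hzw.2 (Subtype.ext h'))
      simp only [coe_insert, coe_singleton, Set.mem_insert_iff, Set.mem_singleton_iff] at ho hp
      by_cases h : b = a
      · subst h
        rcases ho with rfl | rfl | rfl <;> rcases hp with rfl | rfl | rfl <;>
          simp_all [basePlacement, eq_comm]
      · have h' := hne (Ne.symm h)
        rcases ho with rfl | rfl | rfl <;> rcases hp with rfl | rfl | rfl <;>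
          simp_all [basePlacement, eq_comm]
    have hB : #({none, some a, some b} : Finset (Option (Fin n))) ≤ 3 := card_le_three
    refine card_placements_pullback_eq hΓ h3 hB (hinj x y hab) (hinj x' y' hab') ?_ univ
      (subset_univ _) (by simp; omega) _
    ext o p
    have h1 := x.2.2
    have h2 := y.2.2
    have h3 := x'.2.2
    have h4 := y'.2.2
    have h5 : Γ.Adj x.1 y.1 ↔ Γ.Adj x'.1 y'.1 := hadj
    have h6 : Γ.Adj y.1 x.1 ↔ Γ.Adj y'.1 x'.1 := by
      rw [Γ.adj_comm, h5, Γ.adj_comm]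
    simp only [pullback_adj]
    refine and_congr_right fun ho => and_congr_right fun hp => ?_
    simp only [mem_insert, mem_singleton] at ho hp
    by_cases h : b = a
    · subst h
      rcases ho with rfl | rfl | rfl <;> rcases hp with rfl | rfl | rfl <;>
        simp_all [basePlacement, Γ.adj_comm _ v]
    · rcases ho with rfl | rfl | rfl <;> rcases hp with rfl | rfl | rfl <;>
        simp_all [basePlacement, Γ.adj_comm _ v]
  · have hempty : ∀ z w : ({w : V | w ≠ v ∧ ¬ Γ.Adj v w} : Set V), ¬ (a = b ↔ z = w) →
        Nat.card {g : H ↪g Γ.secondSubconstituent v // g a = z ∧ g b = w} = 0 := by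
      intro z w hzw
      have : IsEmpty {g : H ↪g Γ.secondSubconstituent v // g a = z ∧ g b = w} := by
        refine ⟨fun g => hzw ?_⟩
        obtain ⟨g, rfl, rfl⟩ := g
        exact g.injective.eq_iff.symm
      exact Nat.card_of_isEmpty
    rw [hempty x y hab, hempty x' y' fun h => hab (h.trans heq.symm)]

end SimpleGraph

/-! ### Partial and generalized quadrangles -/

namespace IncidenceStructure

open Finset
open scoped Classical

variable {P : Type u} {L : Type v} {I : IncidenceStructure P L} {s t μ : ℕ}

lemma IsPartialQuadrangle.isDiamondFree (hI : I.IsPartialQuadrangle s t μ) :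
    I.pointGraph.IsDiamondFree := by
  intro a b c d hab hac hbc had hbd hcd
  obtain ⟨l, hal, hbl, hcl⟩ := hI.no_triangle a b c hab hbc hac
  obtain ⟨m, ham, hbm, hdm⟩ := hI.no_triangle a b d hab hbd had
  obtain rfl := hI.line_unique a b hab.1 l m hal hbl ham hbm
  exact ⟨hcd, l, hcl, hdm⟩

/-- A partial linear space on finitely many points has finitely many lines, as no line and no
pencil is empty. -/
lemma IsPartialLinearSpace.finite_lines [Finite P] (hI : I.IsPartialLinearSpace s t) :
    Finite L := by
  have h : (⋃ p : P, {l : L | I.Inc p l}) = Set.univ := by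
    refine Set.eq_univ_of_forall fun l => ?_
    have : {p : P | I.Inc p l}.Nonempty :=
      Set.nonempty_of_ncard_ne_zero (by rw [hI.points_on_line]; omega)
    obtain ⟨p, hp⟩ := this
    exact Set.mem_iUnion.2 ⟨p, hp⟩
  rw [← Set.finite_univ_iff, ← h]
  exact Set.finite_iUnion fun p =>
    Set.finite_of_ncard_ne_zero (by rw [hI.lines_through_point]; omega)

namespace IsGeneralizedQuadrangle

lemma inc_of_adj_of_adj (hI : I.IsGeneralizedQuadrangle s t) {p q r : P} {l : L} (hpq : p ≠ q)
    (hp : I.Inc p l) (hq : I.Inc q l) (hrp : I.pointGraph.Adj r p) (hrq : I.pointGraph.Adj r q) :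
    I.Inc r l := by
  by_contra hr
  exact hpq ((hI.antiflag r l hr).unique ⟨hrp, hp⟩ ⟨hrq, hq⟩)

/-- Two common neighbours of a non-collinear pair are not collinear. -/
lemma not_adj_of_common (hI : I.IsGeneralizedQuadrangle s t) {x y c d : P} (hxy : x ≠ y)
    (h : ¬ I.pointGraph.Adj x y) (hcx : I.pointGraph.Adj c x) (hcy : I.pointGraph.Adj c y)
    (hdx : I.pointGraph.Adj d x) (hdy : I.pointGraph.Adj d y) : ¬ I.pointGraph.Adj c d := by
  rintro ⟨hcd, l, hc, hd⟩
  exact h ⟨hxy, l, hI.inc_of_adj_of_adj hcd hc hd hcx.symm hdx.symm,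
    hI.inc_of_adj_of_adj hcd hc hd hcy.symm hdy.symm⟩

lemma card_points [Fintype P] (hI : I.IsGeneralizedQuadrangle s t) (l : L) : #{p | I.Inc p l} = s + 1 := by
  rw [← hI.points_on_line l, Set.ncard_eq_toFinset_card']
  simp

lemma card_lines [Fintype L] (hI : I.IsGeneralizedQuadrangle s t) (p : P) : #{l | I.Inc p l} = t + 1 := by
  rw [← hI.lines_through_point p, Set.ncard_eq_toFinset_card']
  simp

lemma card_points_erase [Fintype P] (hI : I.IsGeneralizedQuadrangle s t) {p : P} {l : L} (hp : I.Inc p l) :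
    #(({q | I.Inc q l} : Finset P).erase p) = s := by
  rw [card_erase_of_mem (by simpa), hI.card_points]
  rfl

lemma card_common_of_adj_of_not_adj [Fintype P] (hI : I.IsGeneralizedQuadrangle s t) {a b c : P}
    (hab : I.pointGraph.Adj a b) (hac : a ≠ c) (hbc : b ≠ c) (hac' : ¬ I.pointGraph.Adj a c)
    (hbc' : ¬ I.pointGraph.Adj b c) :
    #{w | I.pointGraph.Adj w a ∧ I.pointGraph.Adj w b ∧ I.pointGraph.Adj w c} = 1 := by
  obtain ⟨hne, l, ha, hb⟩ := hab
  have hc : ¬ I.Inc c l := fun hc => hac' ⟨hac, l, ha, hc⟩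
  obtain ⟨w, ⟨hcw, hw⟩, huniq⟩ := hI.antiflag c l hc
  rw [card_eq_one]
  refine ⟨w, ?_⟩
  ext z
  simp only [mem_filter, mem_univ, true_and, mem_singleton]
  constructor
  · rintro ⟨hza, hzb, hzc⟩
    exact huniq z ⟨hzc.symm, hI.inc_of_adj_of_adj hne ha hb hza hzb⟩
  · rintro rfl
    have hzc := SimpleGraph.Adj.symm (G := I.pointGraph) hcw
    refine ⟨⟨?_, l, hw, ha⟩, ⟨?_, l, hw, hb⟩, hzc⟩
    · rintro rfl; exact hac' hzc
    · rintro rfl; exact hbc' hzc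

lemma card_common_path [Fintype P] (hI : I.IsGeneralizedQuadrangle s t) {a b c : P}
    (hab : I.pointGraph.Adj a b) (hbc : I.pointGraph.Adj b c) (hac : a ≠ c)
    (hac' : ¬ I.pointGraph.Adj a c) :
    #{w | I.pointGraph.Adj w a ∧ I.pointGraph.Adj w b ∧ I.pointGraph.Adj w c} = 0 := by
  rw [card_eq_zero, filter_eq_empty_iff]
  rintro w - ⟨hwa, hwb, hwc⟩
  exact hI.not_adj_of_common hac hac' hwa hwc hab.symm hbc hwb

lemma card_common_triangle [Fintype P] (hI : I.IsGeneralizedQuadrangle s t) {a b c : P}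
    (hab : I.pointGraph.Adj a b) (hbc : I.pointGraph.Adj b c) (hac : I.pointGraph.Adj a c) :
    #{w | I.pointGraph.Adj w a ∧ I.pointGraph.Adj w b ∧ I.pointGraph.Adj w c} = s + 1 - 3 := by
  obtain ⟨hne, l, ha, hb⟩ := hab
  have hc := hI.inc_of_adj_of_adj hne ha hb hac.symm hbc.symm
  have h3 : #({a, b, c} : Finset P) = 3 := by
    simp [hne, hac.ne, hbc.ne]
  rw [← hI.card_points l, ← h3, ← card_sdiff_of_subset]
  · congr 1
    ext w
    simp only [mem_filter, mem_univ, true_and, mem_sdiff, mem_insert, mem_singleton, not_or]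
    constructor
    · rintro ⟨hwa, hwb, hwc⟩
      exact ⟨hI.inc_of_adj_of_adj hne ha hb hwa hwb, hwa.ne, hwb.ne, hwc.ne⟩
    · rintro ⟨hw, hwa, hwb, hwc⟩
      exact ⟨⟨hwa, l, hw, ha⟩, ⟨hwb, l, hw, hb⟩, ⟨hwc, l, hw, hc⟩⟩
  · intro w hw
    simp only [mem_insert, mem_singleton] at hw
    rcases hw with rfl | rfl | rfl <;> simpa

/-- The neighbours of `c` in the closed neighbourhood of an adjacent point `x` are the points
other than `c` on the line through `c` and `x`. -/
lemma card_closed_common [Fintype P] (hI : I.IsGeneralizedQuadrangle s t) {c x : P}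
    (h : I.pointGraph.Adj c x) :
    #{z | I.pointGraph.Adj c z ∧ (z = x ∨ I.pointGraph.Adj x z)} = s := by
  obtain ⟨hcx, l, hc, hx⟩ := h
  rw [← hI.card_points_erase hc]
  congr 1
  ext z
  simp only [mem_filter, mem_univ, true_and, mem_erase]
  constructor
  · rintro ⟨hcz, rfl | hxz⟩
    · exact ⟨hcx.symm, hx⟩
    · exact ⟨hcz.ne', hI.inc_of_adj_of_adj hcx hc hx hcz.symm hxz.symm⟩
  · rintro ⟨hzc, hz⟩
    refine ⟨⟨hzc.symm, l, hc, hz⟩, ?_⟩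
    by_cases hzx : z = x
    · exact Or.inl hzx
    · exact Or.inr ⟨Ne.symm hzx, l, hx, hz⟩

variable [Fintype P] [Fintype L]

lemma card_neighbors (hI : I.IsGeneralizedQuadrangle s t) (c : P) :
    #{z | I.pointGraph.Adj c z} = s * (t + 1) := by
  have hU : ({z | I.pointGraph.Adj c z} : Finset P) =
      ({l | I.Inc c l} : Finset L).biUnion fun l => ({q | I.Inc q l} : Finset P).erase c := by
    ext z
    simp only [mem_filter, mem_univ, true_and, mem_biUnion, mem_erase]
    constructor
    · rintro ⟨hne, l, hc, hz⟩
      exact ⟨l, hc, hne.symm, hz⟩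
    · rintro ⟨l, hc, hne, hz⟩
      exact ⟨hne.symm, l, hc, hz⟩
  rw [hU, card_biUnion, sum_congr rfl fun l hl => hI.card_points_erase (mem_filter.1 hl).2,
    sum_const, hI.card_lines, smul_eq_mul, mul_comm]
  intro l hl m hm hlm
  have hl' : I.Inc c l := (mem_filter.1 hl).2
  have hm' : I.Inc c m := (mem_filter.1 hm).2
  change Disjoint (_ : Finset P) _
  rw [disjoint_left]
  intro z hz hz'
  simp only [mem_filter, mem_univ, true_and, mem_erase] at hz hz'
  exact hlm (hI.line_unique c z hz.1.symm l m hl' hz.2 hm' hz'.2)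

/-- Each line through `p` carries exactly one point collinear with `q`. -/
lemma card_common_of_not_adj (hI : I.IsGeneralizedQuadrangle s t) {p q : P} (hpq : p ≠ q)
    (h : ¬ I.pointGraph.Adj p q) :
    #{z | I.pointGraph.Adj z p ∧ I.pointGraph.Adj z q} = t + 1 := by
  have hq : ∀ l, I.Inc p l → ¬ I.Inc q l := fun l hp hq => h ⟨hpq, l, hp, hq⟩
  rw [← hI.card_lines p]
  symm
  refine card_bij (fun l hl => (hI.antiflag q l (hq l (mem_filter.1 hl).2)).choose) ?_ ?_ ?_
  · intro l hl
    have hpl : I.Inc p l := (mem_filter.1 hl).2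
    obtain ⟨h1, h2⟩ := (hI.antiflag q l (hq l hpl)).choose_spec.1
    simp only [mem_filter, mem_univ, true_and]
    refine ⟨⟨fun hzp => h ?_, l, h2, hpl⟩, SimpleGraph.Adj.symm (G := I.pointGraph) h1⟩
    rw [← hzp]
    exact SimpleGraph.Adj.symm (G := I.pointGraph) h1
  · intro l hl m hm hlm
    have hpl : I.Inc p l := (mem_filter.1 hl).2
    have hpm : I.Inc p m := (mem_filter.1 hm).2
    obtain ⟨h1, h2⟩ := (hI.antiflag q l (hq l hpl)).choose_spec.1
    obtain ⟨-, h3⟩ := (hI.antiflag q m (hq m hpm)).choose_spec.1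
    rw [← hlm] at h3
    refine hI.line_unique p _ (fun hpz => h ?_) l m hpl h2 hpm h3
    rw [hpz]
    exact SimpleGraph.Adj.symm (G := I.pointGraph) h1
  · intro z hz
    simp only [mem_filter, mem_univ, true_and] at hz
    obtain ⟨hzp, l, hzl, hpl⟩ := hz.1
    exact ⟨l, by simpa using hpl, (hI.antiflag q l (hq l hpl)).unique
      (hI.antiflag q l (hq l hpl)).choose_spec.1 ⟨hz.2.symm, hzl⟩⟩

lemma isPartialQuadrangle (hI : I.IsGeneralizedQuadrangle s t) :
    I.IsPartialQuadrangle s t (t + 1) where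
  toIsPartialLinearSpace := hI.toIsPartialLinearSpace
  no_triangle p q r hpq hqr hpr := by
    obtain ⟨hne, l, hp, hq⟩ := hpq
    exact ⟨l, hp, hq, hI.inc_of_adj_of_adj hne hp hq
      (SimpleGraph.Adj.symm (G := I.pointGraph) hpr)
      (SimpleGraph.Adj.symm (G := I.pointGraph) hqr)⟩
  common_neighbors p q hpq h := by
    rw [← hI.card_common_of_not_adj hpq h, ← Set.ncard_coe_finset]
    congr 1
    ext z
    simp only [coe_filter, mem_univ, true_and]
    rfl

/-- The number of points at distance two from `x`, by double counting paths of length two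
starting at `x`. -/
lemma card_not_adj (hI : I.IsGeneralizedQuadrangle s t) (x : P) :
    #{z | z ≠ x ∧ ¬ I.pointGraph.Adj x z} = s * s * t := by
  have h := sum_card_bipartiteAbove_eq_sum_card_bipartiteBelow
    (s := ({z | z ≠ x ∧ ¬ I.pointGraph.Adj x z} : Finset P))
    (t := ({c | I.pointGraph.Adj x c} : Finset P)) (fun z c => I.pointGraph.Adj c z)
  have h1 : ∀ z ∈ ({z | z ≠ x ∧ ¬ I.pointGraph.Adj x z} : Finset P),
      #(({c | I.pointGraph.Adj x c} : Finset P).bipartiteAbove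
        (fun z c => I.pointGraph.Adj c z) z) = t + 1 := by
    intro z hz
    simp only [mem_filter, mem_univ, true_and] at hz
    rw [← hI.card_common_of_not_adj hz.1.symm hz.2, bipartiteAbove, filter_filter]
    simp only [I.pointGraph.adj_comm x]
  have h2 : ∀ c ∈ ({c | I.pointGraph.Adj x c} : Finset P),
      #(({z | z ≠ x ∧ ¬ I.pointGraph.Adj x z} : Finset P).bipartiteBelow
        (fun z c => I.pointGraph.Adj c z) c) = s * t := by
    intro c hc
    simp only [mem_filter, mem_univ, true_and] at hc
    have h3 := card_filter_add_card_filter_not (s := ({z | I.pointGraph.Adj c z} : Finset P))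
      (fun z => z = x ∨ I.pointGraph.Adj x z)
    rw [hI.card_neighbors, filter_filter, filter_filter, hI.card_closed_common hc.symm] at h3
    have h4 : #(({z | z ≠ x ∧ ¬ I.pointGraph.Adj x z} : Finset P).bipartiteBelow
        (fun z c => I.pointGraph.Adj c z) c) =
        #{z | I.pointGraph.Adj c z ∧ ¬ (z = x ∨ I.pointGraph.Adj x z)} := by
      rw [bipartiteBelow, filter_filter]
      congr 1
      ext z
      simp only [mem_filter, mem_univ, true_and, not_or]
      tauto
    rw [h4]
    rw [mul_add, mul_one] at h3
    omega
  rw [sum_congr rfl h1, sum_congr rfl h2, sum_const, sum_const, hI.card_neighbors, smul_eq_mul,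
    smul_eq_mul] at h
  exact Nat.eq_of_mul_eq_mul_right (show 0 < t + 1 by omega) (h.trans (by ring))

lemma card_not_adj_pair (hI : I.IsGeneralizedQuadrangle s t) {x y : P} (hxy : x ≠ y)
    (h : ¬ I.pointGraph.Adj x y) :
    #{z | (z ≠ x ∧ ¬ I.pointGraph.Adj x z) ∧ (z ≠ y ∧ ¬ I.pointGraph.Adj y z)} +
      (1 + s * (t + 1)) = s * s * t + (t + 1) := by
  have h1 := card_filter_add_card_filter_not
    (s := ({z | z ≠ x ∧ ¬ I.pointGraph.Adj x z} : Finset P))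
    (fun z => z ≠ y ∧ ¬ I.pointGraph.Adj y z)
  rw [hI.card_not_adj, filter_filter, filter_filter] at h1
  have h2 := card_filter_add_card_filter_not (s := ({z | I.pointGraph.Adj y z} : Finset P))
    (fun z => I.pointGraph.Adj x z)
  rw [hI.card_neighbors, filter_filter, filter_filter] at h2
  have h3 := hI.card_common_of_not_adj hxy h
  have h4 : ({z | I.pointGraph.Adj y z ∧ I.pointGraph.Adj x z} : Finset P) =
      ({z | I.pointGraph.Adj z x ∧ I.pointGraph.Adj z y} : Finset P) := by
    ext z
    simp [I.pointGraph.adj_comm z, and_comm]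
  rw [h4, h3] at h2
  have h5 : ({z | (z ≠ x ∧ ¬ I.pointGraph.Adj x z) ∧ ¬ (z ≠ y ∧ ¬ I.pointGraph.Adj y z)} :
      Finset P) = insert y ({z | I.pointGraph.Adj y z ∧ ¬ I.pointGraph.Adj x z} : Finset P) := by
    ext z
    simp only [mem_filter, mem_univ, true_and, mem_insert]
    constructor
    · rintro ⟨hz, hz'⟩
      by_cases hzy : z = y
      · exact Or.inl hzy
      · exact Or.inr ⟨by tauto, hz.2⟩
    · rintro (rfl | ⟨hz, hz'⟩)
      · exact ⟨⟨hxy.symm, h⟩, by simp⟩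
      · refine ⟨⟨?_, hz'⟩, by tauto⟩
        rintro rfl
        exact h hz.symm
  rw [h5, card_insert_of_notMem (by simp)] at h1
  omega

/-- For a common neighbour `c` of non-collinear points `x` and `y`, the neighbours of `c` collinear
with neither `x` nor `y` are those off the lines `cx` and `cy`. -/
lemma card_adj_not_adj_pair (hI : I.IsGeneralizedQuadrangle s t) {x y c : P} (hxy : x ≠ y)
    (h : ¬ I.pointGraph.Adj x y) (hcx : I.pointGraph.Adj c x) (hcy : I.pointGraph.Adj c y) :
    #{z | ((z ≠ x ∧ ¬ I.pointGraph.Adj x z) ∧ (z ≠ y ∧ ¬ I.pointGraph.Adj y z)) ∧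
      I.pointGraph.Adj c z} + (s + s) = s * (t + 1) := by
  rw [← hI.card_neighbors c]
  nth_rewrite 1 [← hI.card_closed_common hcx]
  rw [← hI.card_closed_common hcy]
  rw [← card_union_of_disjoint, ← card_union_of_disjoint]
  · congr 1
    ext z
    simp only [mem_filter, mem_univ, true_and, mem_union]
    tauto
  · rw [disjoint_left]
    intro z hz hz'
    simp only [mem_filter, mem_univ, true_and, mem_union] at hz hz'
    tauto
  · rw [disjoint_left]
    intro z hz hz'
    simp only [mem_filter, mem_univ, true_and] at hz hz'
    obtain ⟨hcz, hz1⟩ := hz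
    rcases hz1 with rfl | hxz
    · rcases hz'.2 with rfl | hyz
      · exact hxy rfl
      · exact h hyz.symm
    · rcases hz'.2 with rfl | hyz
      · exact h hxz
      · exact hI.not_adj_of_common hxy h hcx hcy hxz.symm hyz.symm hcz

/-- In a quadrangle of order `(s, s²)` every triple of pairwise non-collinear points has exactly
`s + 1` common neighbours: for fixed `x` and `y`, the first two moments of this number, taken over
all admissible third points, make its variance about `s + 1` vanish. -/
theorem card_common_triad {s : ℕ} (hI : I.IsGeneralizedQuadrangle s (s ^ 2)) {x y z : P}
    (hxy : x ≠ y) (hxz : x ≠ z) (hyz : y ≠ z) (h : ¬ I.pointGraph.Adj x y)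
    (h' : ¬ I.pointGraph.Adj x z) (h'' : ¬ I.pointGraph.Adj y z) :
    #{w | I.pointGraph.Adj w x ∧ I.pointGraph.Adj w y ∧ I.pointGraph.Adj w z} = s + 1 := by
  set Γ := I.pointGraph with hΓ
  set Z : Finset P := {z | (z ≠ x ∧ ¬ Γ.Adj x z) ∧ (z ≠ y ∧ ¬ Γ.Adj y z)} with hZ
  set C : Finset P := {c | Γ.Adj c x ∧ Γ.Adj c y} with hC
  have hCcard : #C = s ^ 2 + 1 := hI.card_common_of_not_adj hxy h
  have hmC : ∀ {c}, c ∈ C ↔ Γ.Adj c x ∧ Γ.Adj c y := by simp [hC]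
  have hZcard := hI.card_not_adj_pair hxy h
  have hdeg : ∀ c ∈ C, #{z ∈ Z | Γ.Adj c z} + (s + s) = s * (s ^ 2 + 1) := by
    intro c hc
    rw [hmC] at hc
    rw [← hI.card_adj_not_adj_pair hxy h hc.1 hc.2, hZ, filter_filter]
  -- The common neighbours of `c` and `d` are pairwise non-collinear and include `x` and `y`.
  have hpair : ∀ c ∈ C, ∀ d ∈ C, c ≠ d → #{z ∈ Z | Γ.Adj c z ∧ Γ.Adj d z} + 2 = s ^ 2 + 1 := by
    intro c hc d hd hcd
    rw [hmC] at hc hd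
    have hncd := hI.not_adj_of_common hxy h hc.1 hc.2 hd.1 hd.2
    rw [← hI.card_common_of_not_adj hcd hncd, ← card_pair hxy, ← card_union_of_disjoint]
    · congr 1
      ext z
      simp only [mem_filter, mem_univ, true_and, mem_union, mem_insert, mem_singleton, hZ]
      constructor
      · rintro (⟨-, hcz, hdz⟩ | rfl | rfl)
        · exact ⟨hcz.symm, hdz.symm⟩
        · exact ⟨hc.1.symm, hd.1.symm⟩
        · exact ⟨hc.2.symm, hd.2.symm⟩
      · rintro ⟨hzc, hzd⟩
        by_cases hzx : z = x
        · exact Or.inr (Or.inl hzx)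
        by_cases hzy : z = y
        · exact Or.inr (Or.inr hzy)
        exact Or.inl ⟨⟨⟨hzx, hI.not_adj_of_common hcd hncd hc.1.symm hd.1.symm hzc hzd⟩,
          ⟨hzy, hI.not_adj_of_common hcd hncd hc.2.symm hd.2.symm hzc hzd⟩⟩, hzc.symm, hzd.symm⟩
    · rw [disjoint_left]
      intro z hz hz'
      simp only [mem_filter, mem_univ, true_and, mem_insert, mem_singleton, hZ] at hz hz'
      tauto
  have hT : ∀ z, (#{c ∈ C | Γ.Adj c z} : ℤ) = ∑ c ∈ C, if Γ.Adj c z then 1 else 0 := by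
    intro z
    simp
  have hdeg' : ∀ c ∈ C, (∑ z ∈ Z, if Γ.Adj c z then (1 : ℤ) else 0) = s * (s ^ 2 + 1) - 2 * s := by
    intro c hc
    have := hdeg c hc
    rw [sum_boole]
    zify at this
    linarith
  have hsum1 : ∑ z ∈ Z, (#{c ∈ C | Γ.Adj c z} : ℤ) =
      (s ^ 2 + 1) * (s * (s ^ 2 + 1) - 2 * s) := by
    simp_rw [hT]
    rw [sum_comm, sum_congr rfl hdeg', sum_const, hCcard]
    simp
  have hsum2 : ∑ z ∈ Z, (#{c ∈ C | Γ.Adj c z} : ℤ) ^ 2 =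
      (s ^ 2 + 1) * ((s * (s ^ 2 + 1) - 2 * s) + s ^ 2 * (s ^ 2 - 1)) := by
    have hsq : ∀ z, (#{c ∈ C | Γ.Adj c z} : ℤ) ^ 2 =
        ∑ c ∈ C, ∑ d ∈ C, if Γ.Adj c z ∧ Γ.Adj d z then 1 else 0 := by
      intro z
      rw [hT, sq, sum_mul_sum]
      refine sum_congr rfl fun c _ => sum_congr rfl fun d _ => ?_
      split_ifs <;> simp_all
    simp_rw [hsq]
    rw [sum_comm]
    have hc' : ∀ c ∈ C, (∑ z ∈ Z, ∑ d ∈ C, if Γ.Adj c z ∧ Γ.Adj d z then (1 : ℤ) else 0) =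
        (s * (s ^ 2 + 1) - 2 * s) + s ^ 2 * (s ^ 2 - 1) := by
      intro c hc
      rw [sum_comm, ← add_sum_erase C _ hc]
      simp only [and_self]
      rw [hdeg' c hc]
      congr 1
      have : ∀ d ∈ C.erase c, (∑ z ∈ Z, if Γ.Adj c z ∧ Γ.Adj d z then (1 : ℤ) else 0) =
          s ^ 2 - 1 := by
        intro d hd
        rw [mem_erase] at hd
        have := hpair c hc d hd.2 hd.1.symm
        rw [sum_boole]
        zify at this
        linarith
      rw [sum_congr rfl this, sum_const, card_erase_of_mem hc, hCcard]
      simp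
    rw [sum_congr rfl hc', sum_const, hCcard]
    simp
  have hvar : ∑ z ∈ Z, ((#{c ∈ C | Γ.Adj c z} : ℤ) - (s + 1)) ^ 2 = 0 := by
    have e : ∀ z, ((#{c ∈ C | Γ.Adj c z} : ℤ) - (s + 1)) ^ 2 =
        (#{c ∈ C | Γ.Adj c z} : ℤ) ^ 2 - 2 * (s + 1) * (#{c ∈ C | Γ.Adj c z} : ℤ) +
          (s + 1) ^ 2 := fun z => by ring
    simp_rw [e]
    rw [sum_add_distrib, sum_sub_distrib, ← mul_sum, hsum1, hsum2, sum_const]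
    have hZ' : (#Z : ℤ) = s * s * s ^ 2 + (s ^ 2 + 1) - (1 + s * (s ^ 2 + 1)) := by
      zify at hZcard
      linarith
    rw [nsmul_eq_mul, hZ']
    ring
  have hz := (sum_eq_zero_iff_of_nonneg fun z _ => sq_nonneg _).1 hvar z (by
    simp [hZ, hxz.symm, hyz.symm, h', h''])
  have hz' := sub_eq_zero.1 (pow_eq_zero_iff two_ne_zero |>.1 hz)
  rw [hC, filter_filter] at hz'
  simp only [and_assoc] at hz'
  exact_mod_cast hz'

/-- The number of common neighbours of three points, by the number of collinear pairs. -/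
lemma card_common_three {s : ℕ} (hI : I.IsGeneralizedQuadrangle s (s ^ 2)) {a b c : P}
    (hab : a ≠ b) (hac : a ≠ c) (hbc : b ≠ c) :
    #{w | I.pointGraph.Adj w a ∧ I.pointGraph.Adj w b ∧ I.pointGraph.Adj w c} =
      if I.pointGraph.Adj a b then
        if I.pointGraph.Adj a c then
          if I.pointGraph.Adj b c then s + 1 - 3 else 0
        else if I.pointGraph.Adj b c then 0 else 1
      else if I.pointGraph.Adj a c then
        if I.pointGraph.Adj b c then 0 else 1
      else if I.pointGraph.Adj b c then 1 else s + 1 := by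
  have hbac : #{w | I.pointGraph.Adj w a ∧ I.pointGraph.Adj w b ∧ I.pointGraph.Adj w c} =
      #{w | I.pointGraph.Adj w b ∧ I.pointGraph.Adj w a ∧ I.pointGraph.Adj w c} := by
    congr 1; ext; simp only [mem_filter, mem_univ, true_and]; tauto
  have hacb : #{w | I.pointGraph.Adj w a ∧ I.pointGraph.Adj w b ∧ I.pointGraph.Adj w c} =
      #{w | I.pointGraph.Adj w a ∧ I.pointGraph.Adj w c ∧ I.pointGraph.Adj w b} := by
    congr 1; ext; simp only [mem_filter, mem_univ, true_and]; tauto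
  have hbca : #{w | I.pointGraph.Adj w a ∧ I.pointGraph.Adj w b ∧ I.pointGraph.Adj w c} =
      #{w | I.pointGraph.Adj w b ∧ I.pointGraph.Adj w c ∧ I.pointGraph.Adj w a} := by
    congr 1; ext; simp only [mem_filter, mem_univ, true_and]; tauto
  split_ifs with h1 h2 h3 h3 h2 h3 h3
  · exact hI.card_common_triangle h1 h3 h2
  · rw [hbac]
    exact hI.card_common_path h1.symm h2 hbc h3
  · exact hI.card_common_path h1 h3 hac h2
  · exact hI.card_common_of_adj_of_not_adj h1 hac hbc h2 h3
  · rw [hacb]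
    exact hI.card_common_path h2 h3.symm hab h1
  · rw [hacb]
    exact hI.card_common_of_adj_of_not_adj h2 hab hbc.symm h1 fun h => h3 h.symm
  · rw [hbca]
    exact hI.card_common_of_adj_of_not_adj h3 hab.symm hac.symm (fun h => h1 h.symm)
      fun h => h2 h.symm
  · exact hI.card_common_triad hab hac hbc h1 h2 h3

/-- Injective families of at most three points with the same collinearities have equally many
common neighbours. -/
lemma card_common_eq {s : ℕ} (hI : I.IsGeneralizedQuadrangle s (s ^ 2)) {n : ℕ} (hn : n ≤ 3)
    {f f' : Fin n → P} (hf : Function.Injective f) (hf' : Function.Injective f')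
    (h : ∀ i j, I.pointGraph.Adj (f i) (f j) ↔ I.pointGraph.Adj (f' i) (f' j)) :
    #{w | ∀ i, I.pointGraph.Adj w (f i)} = #{w | ∀ i, I.pointGraph.Adj w (f' i)} := by
  interval_cases n
  · simp
  · simp only [Fin.forall_fin_one, I.pointGraph.adj_comm _ (f 0), I.pointGraph.adj_comm _ (f' 0)]
    rw [hI.card_neighbors, hI.card_neighbors]
  · simp only [Fin.forall_fin_two]
    have h01 : f 0 ≠ f 1 := fun h => by simpa using hf h
    have h01' : f' 0 ≠ f' 1 := fun h => by simpa using hf' h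
    by_cases hadj : I.pointGraph.Adj (f 0) (f 1)
    · have aux : ∀ x y, I.pointGraph.Adj x y →
          #{w | I.pointGraph.Adj w x ∧ I.pointGraph.Adj w y} + 1 = s := by
        intro x y hxy
        rw [← hI.card_closed_common hxy, ← card_insert_of_notMem (a := y) (by simp)]
        congr 1
        ext w
        simp only [mem_filter, mem_univ, true_and, mem_insert, I.pointGraph.adj_comm w]
        constructor
        · rintro (rfl | hw)
          · exact ⟨hxy, Or.inl rfl⟩
          · exact ⟨hw.1, Or.inr hw.2⟩
        · tauto
      have h1 := aux _ _ hadj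
      have h2 := aux _ _ ((h 0 1).1 hadj)
      omega
    · rw [hI.card_common_of_not_adj h01 hadj,
        hI.card_common_of_not_adj h01' fun h' => hadj ((h 0 1).2 h')]
  · have hne : ∀ {g : Fin 3 → P}, Function.Injective g → g 0 ≠ g 1 ∧ g 0 ≠ g 2 ∧ g 1 ≠ g 2 :=
      fun hg => ⟨hg.ne (by decide), hg.ne (by decide), hg.ne (by decide)⟩
    have hforall : ∀ (g : Fin 3 → P) w, (∀ i, I.pointGraph.Adj w (g i)) ↔
        I.pointGraph.Adj w (g 0) ∧ I.pointGraph.Adj w (g 1) ∧ I.pointGraph.Adj w (g 2) :=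
      fun g w => by simp [Fin.forall_fin_succ]
    simp only [hforall]
    obtain ⟨n1, n2, n3⟩ := hne hf
    obtain ⟨m1, m2, m3⟩ := hne hf'
    rw [hI.card_common_three n1 n2 n3, hI.card_common_three m1 m2 m3]
    simp only [h]

theorem isIsoregular {s : ℕ} (hI : I.IsGeneralizedQuadrangle s (s ^ 2)) :
    I.pointGraph.IsIsoregular 3 := by
  rintro X Y hX - ⟨φ⟩
  have hcount : ∀ (Z : Finset P) (e : Fin #X ≃ (Z : Set P)),
      {w : P | w ∉ Z ∧ ∀ x ∈ Z, I.pointGraph.Adj w x}.ncard =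
        #{w | ∀ i, I.pointGraph.Adj w (e i).1} := by
    intro Z e
    rw [← Set.ncard_coe_finset]
    congr 1
    ext w
    simp only [coe_filter, mem_univ, true_and, Set.mem_ofPred_eq]
    rw [e.forall_congr_left (p := fun i => I.pointGraph.Adj w (e i).1)]
    simp only [Equiv.apply_symm_apply, Subtype.forall, mem_coe]
    exact ⟨fun h => h.2, fun h => ⟨fun hw => (h w hw).ne rfl, h⟩⟩
  let e : Fin #X ≃ (X : Set P) := X.equivFin.symm
  rw [hcount X e, hcount Y (e.trans φ.toEquiv)]
  refine hI.card_common_eq hX (Subtype.val_injective.comp e.injective)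
    (Subtype.val_injective.comp (e.trans φ.toEquiv).injective) fun i j => ?_
  exact (φ.map_adj_iff (v := e i) (w := e j)).symm

end IsGeneralizedQuadrangle

end IncidenceStructure

theorem mainTheorem11 {P : Type u} {L : Type v} [Finite P] (I : IncidenceStructure P L) :
    (∀ s t μ : ℕ, I.IsPartialQuadrangle s t μ → I.pointGraph.IsIsoregular 3 →
      ∀ x : P, (I.pointGraph.secondSubconstituent x).SatisfiesVertexCondition 6) ∧
    (∀ q : ℕ, I.IsGeneralizedQuadrangle q (q ^ 2) →
      ∀ x : P, (I.pointGraph.secondSubconstituent x).SatisfiesVertexCondition 6) := by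
  have := Fintype.ofFinite P
  refine ⟨fun s t μ hI h3 x => SimpleGraph.secondSubconstituent_satisfiesVertexCondition
    hI.isDiamondFree h3 x, fun q hI x => ?_⟩
  have := hI.toIsPartialLinearSpace.finite_lines
  have := Fintype.ofFinite L
  exact SimpleGraph.secondSubconstituent_satisfiesVertexCondition
    hI.isPartialQuadrangle.isDiamondFree hI.isIsoregular x
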